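/- A $(K,K',N)$ hotplug coded caching scheme consists of the following. A server holds $N$ files of $B\ge 1$ bits each. Each of $K$ users has a cache of $MB$ bits, which is filled with a function of the files before it is known which users will be active and what they will demand. Afterwards a set $I$ of $K'$ active users and their demands $(d_k)_{k\in I}\in[N]^I$ are revealed, and the server broadcasts $RB$ bits that depend on $I$, the demands and the files. For every $I$ with $|I|=K'$, every demand vector and every content of the files, each $k\in I$ must recover file $d_k$ exactly from its cache and the broadcast. A pair $(M,R)$ is achievable if for some $B$ there is such a scheme with caches of at most $MB$ bits and broadcasts of at most $RB$ bits. The rate $R$ is optimal at memory $M$ if it is the smallest rate achievable with memory $M$. Let $q\ge 3$ be a prime power, let $N\ge 1$, and let $a,a_1,a_2$ be integers with $0\le a_1\le q^2-q-1$, $0\le a_2\le q$, $0\le a<a_2$ and $q(q+1)=a+3a_1+2a_2$. Put $$\frac MN=\frac{q(q+1)}{3(a_1+a_2)},\qquad R=\frac{3(a_1+a_2)-q(q+1)}{3(a_1+a_2)}=1-\frac MN .$$ Then: 1. There is a $3$-$(q^2+1,q+1,1)$ design $(X,\mathcal A)$, with the set $X=[q^2+1]$ of users as point set, and a $(q^2+1,3,N)$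 hotplug coded caching scheme of memory exactly $M$ and rate exactly $R$ that is obtained from it as follows. Let $\mathcal R$ be the set of pairs $(Y,i)$ with $Y\subset\{1,2,3\}$, $|Y|\in\{1,2\}$, $1\le i\le a_{|Y|}$. Each file is divided into $|\mathcal R|=3(a_1+a_2)$ subfiles, which are elements of a field with $2^m$ elements, and encoded by an MDS code of dimension $|\mathcal R|$ into coded subfiles $C_{n,A}$, $A\in\mathcal A$. User $k$ caches all $C_{n,A}$ with $k\in A$. If the active users are $u_1<u_2<u_3$, there is an injection $\psi:\mathcal R\to\mathcal A$ with $u_j\in\psi(Y,i)\iff j\in Y$, and for each pair $s=(Y\cup\{j\},i)$ with $(Y,i)\in\mathcal R$, $j\notin Y$, outside a fixed set $T$ of pairs, the server sends $\sum C_{d_{u_j},\psi(Y,i)}$, the sum being over all $(Y,i)\in\mathcal R$ and $j\notin Y$ with $(Y\cup\{j\},i)=s$. 2. The point $(M,R)$ meets the cut-set bound: $$R=\max_{1\le s\le\min(N,3)}\Bigl(s-\frac{s}{\lfloor N/s\rfloor}M\Bigr).$$ 3. In the $(q^2+1,3,N)$ hotplug system, $R$ is optimal at memory $M$. -/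

import Mathlib

/-- A `(K, K', N)` hotplug coded caching scheme with files of `B` bits, caches of `c` bits and
transmissions of `r` bits.  The placement knows neither the active set `I` nor the demands `d`;
the delivery knows both.  Every active user must recover its file exactly, for every active set of
size `K'`, every demand vector and every content of the files. -/
structure HotplugScheme (K K' N B c r : ℕ) where
  /-- the cache of each user, as a function of the `N` files -/
  place : (Fin N → Fin B → Bool) → Fin K → Fin c → Bool
  /-- the broadcast, as a function of the active set, the demands and the files -/
  deliver : (I : Finset (Fin K)) → (I → Fin N) → (Fin N → Fin B → Bool) → Fin r → Bool
  /-- the decoder of an active user -/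
  decode : (I : Finset (Fin K)) → (I → Fin N) → I → (Fin c → Bool) → (Fin r → Bool) →
    Fin B → Bool
  correct : ∀ I : Finset (Fin K), I.card = K' → ∀ (d : I → Fin N) (W : Fin N → Fin B → Bool)
    (k : I), decode I d k (place W k) (deliver I d W) = W (d k)

/-- Memory `M` and rate `R` (both in units of files) are achievable in the `(K, K', N)` hotplug
system. -/
def IsAchievable (K K' N : ℕ) (M R : ℝ) : Prop :=
  ∃ B c r : ℕ, 0 < B ∧ (c : ℝ) ≤ M * B ∧ (r : ℝ) ≤ R * B ∧ Nonempty (HotplugScheme K K' N B c r)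

/-- `R` is optimal at memory `M`: it is the smallest achievable rate. -/
def IsOptimalRate (K K' N : ℕ) (M R : ℝ) : Prop :=
  IsLeast {R' : ℝ | IsAchievable K K' N M R'} R

/-- `R` equals the cut-set bound for `N` files, `K'` users and memory `M`, that is
`max_{1 ≤ s ≤ min (N, K')} (s - s / ⌊N / s⌋ * M)`. -/
def MeetsCutSetBound (N K' : ℕ) (M R : ℝ) : Prop :=
  IsGreatest ((fun s : ℕ => (s : ℝ) - (s : ℝ) / ((N / s : ℕ) : ℝ) * M) ''
    Set.Icc 1 (min N K')) R

/-- `t-(v, k, l)` designs (without repeated blocks) on the point set `X`. -/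
structure IsTDesign {X : Type} [Fintype X] [DecidableEq X] (t v k l : ℕ)
    (blocks : Finset (Finset X)) : Prop where
  t_pos : 0 < t
  l_pos : 0 < l
  t_le : t ≤ k
  k_lt : k < v
  card_points : Fintype.card X = v
  card_block : ∀ A ∈ blocks, A.card = k
  card_through : ∀ Y : Finset X, Y.card = t → (blocks.filter (fun A => Y ⊆ A)).card = l

/-- The division of `B`-bit files into subfiles indexed by `ρ`, of `m` bits each, read as elements
of a field with `2 ^ m` elements, together with the generator matrix of an MDS code whose coded
symbols are indexed by `φ`. -/
structure SubfileCode (ρ φ : Type) (B : ℕ) where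
  m : ℕ
  F : Type
  [field : Field F]
  split : Fin B ≃ ρ × Fin m
  symbol : (Fin m → Bool) ≃ F
  G : Matrix ρ φ F
  /-- any `|ρ|` columns of `G` are linearly independent -/
  mds : ∀ g : ρ ↪ φ, LinearIndependent F (fun i : ρ => fun f : ρ => G f (g i))

attribute [instance] SubfileCode.field

namespace SubfileCode

variable {ρ φ σ : Type} {B : ℕ}

/-- The subfile with index `f` of the file `w`. -/
def subfile (C : SubfileCode ρ φ B) (w : Fin B → Bool) (f : ρ) : C.F :=
  C.symbol (fun i => w (C.split.symm (f, i)))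

/-- The coded subfile with index `x` of the file `w`. -/
def coded [Fintype ρ] (C : SubfileCode ρ φ B) (w : Fin B → Bool) (x : φ) : C.F :=
  ∑ f : ρ, C.G f x * C.subfile w f

/-- The transmission attached to the integer `s` of the array `A`: the sum of the coded subfiles
`C_{w_j, ψ f}` over all positions `(f, j)` of `s` in `A`, where `w_j` is the file demanded by the
`j`-th active user. -/
def transmission [Fintype ρ] [DecidableEq σ] {K' : ℕ} (C : SubfileCode ρ φ B)
    (A : ρ → Fin K' → Option σ) (ψ : ρ ↪ φ) (w : Fin K' → Fin B → Bool) (s : σ) : C.F :=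
  ∑ f : ρ, ∑ j : Fin K', if A f j = some s then C.coded (w j) (ψ f) else 0

end SubfileCode

/-- `S` is the scheme obtained from the placement array `P` (`P x k` means that there is a star in
row `x` and column `k`) and the delivery array `A` (`none` is the star, `some s` the integer `s`)
from which the integers in `T` have been removed.

* The cache of user `k` consists of the coded subfiles of all files at the stars in column `k`.
* For an active set `I` there are rows `ψ` of `P` whose stars in the columns `I` are at the same
  positions as those of `A`, and the server sends one transmission for every integer of `A` that is
  not in `T`.

The bijections `e` fix the order in which the bits are stored and sent. -/
def IsArrayScheme {ρ φ σ : Type} [Fintype ρ] [DecidableEq σ] {K K' N B c r : ℕ}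
    (P : φ → Fin K → Prop) (A : ρ → Fin K' → Option σ) (T : Set σ)
    (S : HotplugScheme K K' N B c r) : Prop :=
  ∃ C : SubfileCode ρ φ B,
    (∀ k : Fin K, ∃ e : Fin c ≃ Fin N × {x : φ // P x k} × Fin C.m,
      ∀ (W : Fin N → Fin B → Bool) (b : Fin c),
        S.place W k b = C.symbol.symm (C.coded (W (e b).1) (e b).2.1) (e b).2.2) ∧
    ∀ (I : Finset (Fin K)) (hI : I.card = K'),
      ∃ ψ : ρ ↪ φ,
        (∀ f j, A f j = none ↔ P (ψ f) (I.orderIsoOfFin hI j)) ∧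
        ∀ d : I → Fin N,
          ∃ e : Fin r ≃ {s : σ // s ∉ T ∧ ∃ f j, A f j = some s} × Fin C.m,
            ∀ (W : Fin N → Fin B → Bool) (b : Fin r),
              S.deliver I d W b =
                C.symbol.symm
                  (C.transmission A ψ (fun j => W (d (I.orderIsoOfFin hI j))) (e b).1) (e b).2

/-- The placement array of a design: rows are blocks, columns are points, and the stars are at the
incidences. -/
def designPlacement {K : ℕ} (blocks : Finset (Finset (Fin K))) (A : {A // A ∈ blocks})
    (i : Fin K) : Prop :=
  i ∈ A.1

/-- The rows `(Y, i)` of the delivery array: `Y ⊆ [t]` with `1 ≤ |Y| ≤ t - 1` and `i ∈ [a_{|Y|}]`. -/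
abbrev DesignRow (t : ℕ) (a : ℕ → ℕ) : Type :=
  Σ Y : {Y : Finset (Fin t) // Y.Nonempty ∧ Y ≠ Finset.univ}, Fin (a Y.1.card)

/-- The delivery array: in row `(Y, i)` and column `j` there is a star if `j ∈ Y`, and the
"integer" `(Y ∪ {j}, i)` otherwise. -/
def designDelivery (t : ℕ) (a : ℕ → ℕ) (y : DesignRow t a) (j : Fin t) :
    Option (Finset (Fin t) × ℕ) :=
  if j ∈ y.1.1 then none else some (insert j y.1.1, (y.2 : ℕ))

/-! The design is the inversive plane: points are the projective line over `F_{q^2}`, blocks the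
images of the line over `F_q`. Three points lie on one block because projectivities are transitive
on ordered triples and one fixing three points is trivial. Double counting shows that, for three
distinct points, `q^2-q-1` blocks meet them in a given single point and `q` in a given pair; these
are exactly the bounds on `a₁` and `a₂`, so the rows of the delivery array can be realised by
distinct blocks.

A user caches `q(q+1)` coded subfiles of each file and, by the MDS property, needs `3(a₁+a₂) -
q(q+1) = a₂ - a` more of its own. The transmission for `({1,2,3}, i)` is a sum of three coded
subfiles, one for each active user, and each user caches the two terms that are not its own. So the
indices `a ≤ i < a₂` suffice and all other integers are dropped.

Conversely, one cache and the `N` broadcasts for constant demands determine all files, so `R ≥ 1 -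
M/N`. Since `M/N ≥ 1/2`, this is also the largest cut-set bound. -/

open scoped MatrixGroups in
/-- `GL(2, K)` acts `3`-transitively on the projective line. -/
theorem OnePoint.exists_smul_eq_of_distinct {K : Type*} [Field K] [DecidableEq K]
    {a b c : OnePoint K} (hab : a ≠ b) (hac : a ≠ c) (hbc : b ≠ c) :
    ∃ g : GL (Fin 2) K, g • (OnePoint.infty : OnePoint K) = a ∧
      g • ((0 : K) : OnePoint K) = b ∧ g • ((1 : K) : OnePoint K) = c := by
  have key : ∀ w x y z : K, w * z - x * y ≠ 0 →
      ∃ g : GL (Fin 2) K, g 0 0 = w ∧ g 0 1 = x ∧ g 1 0 = y ∧ g 1 1 = z := fun w x y z h =>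
    ⟨Matrix.GeneralLinearGroup.mkOfDetNeZero !![w, x; y, z] (by simpa [Matrix.det_fin_two] using h),
      by simp [Matrix.GeneralLinearGroup.mkOfDetNeZero]⟩
  -- The matrix with rows `(w, x)` and `(y, z)` sends `∞`, `0`, `1` to `w/y`, `x/z`, `(w+x)/(y+z)`.
  have finish : ∀ w x y z : K, w * z - x * y ≠ 0 →
      (if y = 0 then OnePoint.infty else ((w / y : K) : OnePoint K)) = a →
      (if z = 0 then OnePoint.infty else ((x / z : K) : OnePoint K)) = b →
      (if y + z = 0 then OnePoint.infty else (((w + x) / (y + z) : K) : OnePoint K)) = c →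
      ∃ g : GL (Fin 2) K, g • (OnePoint.infty : OnePoint K) = a ∧
        g • ((0 : K) : OnePoint K) = b ∧ g • ((1 : K) : OnePoint K) = c := by
    intro w x y z h ha hb hc
    obtain ⟨g, h₁, h₂, h₃, h₄⟩ := key w x y z h
    refine ⟨g, ?_, ?_, ?_⟩
    · rw [OnePoint.smul_infty_eq_ite, h₁, h₃]; exact ha
    · rw [OnePoint.smul_some_eq_ite, h₁, h₂, h₃, h₄]; simpa using hb
    · rw [OnePoint.smul_some_eq_ite, h₁, h₂, h₃, h₄]; simpa using hc
  cases a with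
  | infty =>
    cases b with
    | infty => exact absurd rfl hab
    | coe b =>
      cases c with
      | infty => exact absurd rfl hac
      | coe c =>
        have h : c - b ≠ 0 := sub_ne_zero.2 fun h => hbc (by rw [h])
        exact finish (c - b) b 0 1 (by simpa using h) (by simp) (by simp) (by simp)
  | coe a =>
    cases b with
    | infty =>
      cases c with
      | infty => exact absurd rfl hbc
      | coe c =>
        have h : c - a ≠ 0 := sub_ne_zero.2 fun h => hac (by rw [h])
        exact finish a (c - a) 1 0 (by simpa [sub_eq_zero, eq_comm] using h) (by simp)
          (by simp) (by simp)
    | coe b =>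
      have h : b - a ≠ 0 := sub_ne_zero.2 fun h => hab (by rw [h])
      cases c with
      | infty =>
        exact finish a (-b) 1 (-1) (by convert h using 1; ring) (by simp) (by simp) (by simp)
      | coe c =>
        have h₁ : c - a ≠ 0 := sub_ne_zero.2 fun h => hac (by rw [h])
        have h₂ : b - c ≠ 0 := sub_ne_zero.2 fun h => hbc (by rw [h])
        have h₃ : b - c + (c - a) = b - a := by ring
        -- The columns represent `a` and `b`, scaled so that their sum is `(b - a)` times `(c, 1)`.
        refine finish (a * (b - c)) (b * (c - a)) (b - c) (c - a) ?_ ?_ ?_ ?_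
        · have : a * (b - c) * (c - a) - b * (c - a) * (b - c) = -((b - c) * (c - a) * (b - a)) := by
            ring
          rw [this]
          exact neg_ne_zero.2 (mul_ne_zero (mul_ne_zero h₂ h₁) h)
        · rw [if_neg h₂, mul_div_cancel_right₀ _ h₂]
        · rw [if_neg h₁, mul_div_cancel_right₀ _ h₁]
        · rw [h₃, if_neg h, show a * (b - c) + b * (c - a) = c * (b - a) by ring,
            mul_div_cancel_right₀ _ h]

/-- A projectivity of the line that fixes three points is the identity. -/
theorem OnePoint.smul_eq_self_of_fixes {K : Type*} [Field K] [DecidableEq K]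
    {g : Matrix.GeneralLinearGroup (Fin 2) K}
    (h₁ : g • (OnePoint.infty : OnePoint K) = OnePoint.infty)
    (h₂ : g • ((0 : K) : OnePoint K) = ((0 : K) : OnePoint K))
    (h₃ : g • ((1 : K) : OnePoint K) = ((1 : K) : OnePoint K)) (x : OnePoint K) : g • x = x := by
  have h10 := OnePoint.smul_infty_eq_self_iff.1 h₁
  rw [OnePoint.smul_some_eq_ite] at h₂ h₃
  simp only [h10, zero_mul, zero_add, mul_zero] at h₂ h₃
  have h11 : g 1 1 ≠ 0 := fun h => by simp [h] at h₂
  have h01 : g 0 1 = 0 := by simpa [h11] using h₂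
  have h00 : g 0 0 = g 1 1 := by simpa [h11, h01, div_eq_one_iff_eq] using h₃
  cases x with
  | infty => exact h₁
  | coe x => simp [OnePoint.smul_some_eq_ite, h10, h11, h01, h00]

/-! ### Sublines of a projective line -/

section Subline

variable (k L : Type*) [Field k] [Field L] [Algebra k L]

/-- The projective line over `k` inside the projective line over an extension field `L`. -/
def baseSubline : Set (OnePoint L) :=
  Set.range (OnePoint.map (algebraMap k L))

-- The preimages of `∞`, `0`, `1` under `g` are three points over `k`, so some `h` over `k` carries
-- `∞`, `0`, `1` to them. Then `g * h` fixes these three points and acts trivially, while `h`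
-- preserves the subline.
open scoped Pointwise in
theorem eq_baseSubline_of_mem [DecidableEq L] {g : Matrix.GeneralLinearGroup (Fin 2) L}
    (h₁ : (OnePoint.infty : OnePoint L) ∈ g • baseSubline k L)
    (h₂ : ((0 : L) : OnePoint L) ∈ g • baseSubline k L)
    (h₃ : ((1 : L) : OnePoint L) ∈ g • baseSubline k L) :
    g • baseSubline k L = baseSubline k L := by
  classical
  obtain ⟨_, ⟨a, rfl⟩, ha⟩ := h₁
  obtain ⟨_, ⟨b, rfl⟩, hb⟩ := h₂
  obtain ⟨_, ⟨c, rfl⟩, hc⟩ := h₃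
  simp only at ha hb hc
  obtain ⟨h, ha', hb', hc'⟩ := OnePoint.exists_smul_eq_of_distinct (a := a) (b := b) (c := c)
    (by rintro rfl; simp [ha] at hb) (by rintro rfl; simp [ha] at hc)
    (by rintro rfl; simp [hb] at hc)
  have hmap : (h.map (algebraMap k L)) • baseSubline k L = baseSubline k L := by
    ext x
    constructor
    · rintro ⟨_, ⟨y, rfl⟩, rfl⟩
      exact ⟨h • y, OnePoint.map_smul _ _ _⟩
    · rintro ⟨y, rfl⟩
      refine ⟨_, ⟨h⁻¹ • y, rfl⟩, ?_⟩
      simp [← OnePoint.map_smul]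
  have hfix : ∀ x : OnePoint L, (g * h.map (algebraMap k L)) • x = x := by
    refine OnePoint.smul_eq_self_of_fixes ?_ ?_ ?_
    · rw [← ha', OnePoint.map_smul, ← mul_smul] at ha; simpa using ha
    · rw [← hb', OnePoint.map_smul, ← mul_smul] at hb; simpa using hb
    · rw [← hc', OnePoint.map_smul, ← mul_smul] at hc; simpa using hc
  calc g • baseSubline k L = (g * h.map (algebraMap k L)) • baseSubline k L := by
        rw [mul_smul, hmap]
    _ = baseSubline k L := by
        ext x; simp [Set.mem_smul_set, hfix]

open scoped Pointwise in
/-- Three distinct points of the projective line over `L` lie on exactly one image of the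
projective line over `k`. -/
theorem existsUnique_subline [DecidableEq L] {a b c : OnePoint L} (hab : a ≠ b) (hac : a ≠ c)
    (hbc : b ≠ c) :
    ∃! s : Set (OnePoint L), (∃ g : Matrix.GeneralLinearGroup (Fin 2) L, s = g • baseSubline k L) ∧
      a ∈ s ∧ b ∈ s ∧ c ∈ s := by
  obtain ⟨g, rfl, rfl, rfl⟩ := OnePoint.exists_smul_eq_of_distinct hab hac hbc
  refine ⟨g • baseSubline k L, ⟨⟨g, rfl⟩, ?_, ?_, ?_⟩, ?_⟩
  · exact Set.smul_mem_smul_set ⟨OnePoint.infty, rfl⟩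
  · exact Set.smul_mem_smul_set ⟨((0 : k) : OnePoint k), by simp⟩
  · exact Set.smul_mem_smul_set ⟨((1 : k) : OnePoint k), by simp⟩
  · rintro _ ⟨⟨h, rfl⟩, h₁, h₂, h₃⟩
    have := eq_baseSubline_of_mem k L (g := g⁻¹ * h)
      (by rwa [mul_smul, Set.mem_inv_smul_set_iff])
      (by rwa [mul_smul, Set.mem_inv_smul_set_iff])
      (by rwa [mul_smul, Set.mem_inv_smul_set_iff])
    rwa [mul_smul, inv_smul_eq_iff] at this

open scoped Pointwise in
theorem ncard_smul_baseSubline [DecidableEq L] (g : Matrix.GeneralLinearGroup (Fin 2) L) [Finite k] :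
    (g • baseSubline k L).ncard = Nat.card k + 1 := by
  have hinj : Function.Injective (OnePoint.map (algebraMap k L)) :=
    Option.map_injective (algebraMap k L).injective
  rw [Set.ncard_smul_set, baseSubline, ← Set.image_univ, Set.ncard_image_of_injective _ hinj,
    Set.ncard_univ]
  exact Finite.card_option

end Subline

/-! ### The inversive plane -/

theorem exists_quadratic_extension {q : ℕ} (hq : IsPrimePow q) :
    ∃ (k L : Type) (_ : Field k) (_ : Field L) (_ : Algebra k L) (_ : Finite k) (_ : Finite L),
      Nat.card k = q ∧ Nat.card L = q ^ 2 := by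
  obtain ⟨p, n, hp, hn, rfl⟩ := (isPrimePow_nat_iff q).1 hq
  have : Fact p.Prime := ⟨hp⟩
  refine ⟨GaloisField p n, FiniteField.Extension (GaloisField p n) p 2, inferInstance,
    inferInstance, inferInstance, inferInstance, inferInstance, GaloisField.card p n hn.ne', ?_⟩
  rw [FiniteField.natCard_extension, GaloisField.card p n hn.ne']

open scoped Pointwise in
/-- The inversive plane of order `q`. -/
theorem exists_isTDesign_inversive {q : ℕ} (hq : IsPrimePow q) :
    ∃ blocks : Finset (Finset (Fin (q ^ 2 + 1))), IsTDesign 3 (q ^ 2 + 1) (q + 1) 1 blocks := by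
  classical
  obtain ⟨k, L, _, _, _, _, _, hk, hL⟩ := exists_quadratic_extension hq
  have h2 := hq.two_le
  have hcard : Nat.card (OnePoint L) = q ^ 2 + 1 := by
    rw [← hL]; exact Finite.card_option
  have : Finite (OnePoint L) := Nat.finite_of_card_ne_zero (by omega)
  let e : Fin (q ^ 2 + 1) ≃ OnePoint L := (finCongr hcard.symm).trans (Finite.equivFin _).symm
  refine ⟨Finset.univ.filter fun A => ∃ g : Matrix.GeneralLinearGroup (Fin 2) L,
    e '' (A : Set (Fin (q ^ 2 + 1))) = g • baseSubline k L, by norm_num, by norm_num, by omega,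
    by nlinarith, by simp, ?_, ?_⟩
  · intro A hA
    obtain ⟨g, hg⟩ := (Finset.mem_filter.1 hA).2
    have h := ncard_smul_baseSubline k L g
    rwa [← hg, Set.ncard_image_of_injective _ e.injective, Set.ncard_coe_finset, hk] at h
  · intro Y hY
    obtain ⟨x, y, z, hxy, hxz, hyz, rfl⟩ := Finset.card_eq_three.1 hY
    obtain ⟨s, ⟨⟨g, hg⟩, hx, hy, hz⟩, huniq⟩ := existsUnique_subline k L
      (e.injective.ne hxy) (e.injective.ne hxz) (e.injective.ne hyz)
    rw [Finset.card_eq_one]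
    refine ⟨(Set.toFinite (e ⁻¹' s)).toFinset, ?_⟩
    ext A
    simp only [Finset.mem_filter, Finset.mem_univ, true_and, Finset.mem_singleton]
    constructor
    · rintro ⟨⟨h, hh⟩, hA⟩
      simp only [Finset.insert_subset_iff, Finset.singleton_subset_iff] at hA
      have := huniq (e '' (A : Set (Fin (q ^ 2 + 1)))) ⟨⟨h, hh⟩, by simpa using hA⟩
      ext i
      rw [Set.Finite.mem_toFinset, ← this, Set.mem_preimage, e.injective.mem_set_image,
        Finset.mem_coe]
    · rintro rfl
      refine ⟨⟨g, ?_⟩, ?_⟩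
      · rw [← hg, Set.Finite.coe_toFinset, Set.image_preimage_eq _ e.surjective]
      · simp [Finset.insert_subset_iff, hx, hy, hz]

/-! ### Intersection numbers of the design -/

section DesignCounts

variable {X : Type} [Fintype X] [DecidableEq X]

/-- Double counting of the incidences between points outside `Y` and blocks through `Y`. -/
theorem card_through_mul_eq {blocks : Finset (Finset X)} {k l : ℕ}
    (hk : ∀ A ∈ blocks, A.card = k) (Y : Finset X)
    (hl : ∀ x ∉ Y, (blocks.filter (insert x Y ⊆ ·)).card = l) :
    (Fintype.card X - Y.card) * l = (blocks.filter (Y ⊆ ·)).card * (k - Y.card) := by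
  have h := Finset.sum_card_bipartiteAbove_eq_sum_card_bipartiteBelow
    (s := Yᶜ) (t := blocks.filter (Y ⊆ ·)) (fun x A => x ∈ A)
  rw [Finset.sum_const_nat (m := l), Finset.sum_const_nat (m := k - Y.card),
    Finset.card_compl] at h
  · exact h
  · intro A hA
    obtain ⟨hA, hYA⟩ := Finset.mem_filter.1 hA
    rw [← hk A hA, ← Finset.card_sdiff_of_subset hYA]
    congr 1
    ext x
    simp [Finset.bipartiteBelow, and_comm]
  · intro x hx
    rw [← hl x (Finset.mem_compl.1 hx)]
    congr 1
    ext A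
    simp [Finset.bipartiteAbove, Finset.insert_subset_iff]
    tauto

variable {q : ℕ} {blocks : Finset (Finset X)}

/-- Each of the other `q^2 - 1` points lies on one block through the pair, and each such block
contains `q - 1` of them. -/
theorem IsTDesign.card_through_pair (hD : IsTDesign 3 (q ^ 2 + 1) (q + 1) 1 blocks) {x y : X}
    (hxy : x ≠ y) : (blocks.filter fun A => x ∈ A ∧ y ∈ A).card = q + 1 := by
  have hq : 2 ≤ q := by have := hD.t_le; omega
  have h := card_through_mul_eq hD.card_block {x, y} (l := 1) fun z hz =>
    hD.card_through _ (by rw [Finset.card_insert_of_notMem hz, Finset.card_pair hxy])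
  rw [hD.card_points, Finset.card_pair hxy] at h
  simp only [Finset.insert_subset_iff, Finset.singleton_subset_iff] at h
  obtain ⟨p, rfl⟩ : ∃ p, q = p + 1 := ⟨q - 1, by omega⟩
  refine Nat.eq_of_mul_eq_mul_right (show 0 < p by omega) ?_
  rw [show p + 1 + 1 - 2 = p by omega] at h
  rw [← h, mul_one, show (p + 1) ^ 2 + 1 = (p + 1 + 1) * p + 2 by ring, Nat.add_sub_cancel]

theorem IsTDesign.card_through_point (hD : IsTDesign 3 (q ^ 2 + 1) (q + 1) 1 blocks) (x : X) :
    (blocks.filter fun A => x ∈ A).card = q * (q + 1) := by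
  have hq : 2 ≤ q := by have := hD.t_le; omega
  have h := card_through_mul_eq hD.card_block {x} (l := q + 1) fun y hy => by
    rw [← hD.card_through_pair (x := y) (y := x) (by simpa using hy)]
    simp only [Finset.insert_subset_iff, Finset.singleton_subset_iff]
  rw [hD.card_points, Finset.card_singleton] at h
  simp only [Finset.singleton_subset_iff, Nat.add_sub_cancel] at h
  refine Nat.eq_of_mul_eq_mul_right (show 0 < q by omega) ?_
  rw [← h]
  ring

theorem IsTDesign.card_attach_through_point (hD : IsTDesign 3 (q ^ 2 + 1) (q + 1) 1 blocks)
    (x : X) : (Finset.univ.filter fun A : {A // A ∈ blocks} => x ∈ A.1).card = q * (q + 1) := by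
  rw [← hD.card_through_point x, ← Finset.card_map (Function.Embedding.subtype _)]
  congr 1
  ext A
  simp [and_comm]

theorem IsTDesign.card_through_triple (hD : IsTDesign 3 (q ^ 2 + 1) (q + 1) 1 blocks) {x y z : X}
    (hxy : x ≠ y) (hxz : x ≠ z) (hyz : y ≠ z) :
    (blocks.filter fun A => x ∈ A ∧ y ∈ A ∧ z ∈ A).card = 1 := by
  rw [← hD.card_through {x, y, z} (Finset.card_eq_three.2 ⟨x, y, z, hxy, hxz, hyz, rfl⟩)]
  simp only [Finset.insert_subset_iff, Finset.singleton_subset_iff]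

theorem IsTDesign.card_inter_pair (hD : IsTDesign 3 (q ^ 2 + 1) (q + 1) 1 blocks) {x y z : X}
    (hxy : x ≠ y) (hxz : x ≠ z) (hyz : y ≠ z) :
    (blocks.filter fun A => x ∈ A ∧ y ∈ A ∧ z ∉ A).card = q := by
  have h := Finset.card_filter_add_card_filter_not (s := blocks.filter fun A => x ∈ A ∧ y ∈ A)
    (fun A => z ∈ A)
  simp only [Finset.filter_filter, and_assoc] at h
  rw [hD.card_through_triple hxy hxz hyz, hD.card_through_pair hxy] at h
  omega

/-- Of the `q(q+1)` blocks through `x`, remove the `q+1` through `y`, then the `q` through `z` but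
not `y`. -/
theorem IsTDesign.card_inter_point (hD : IsTDesign 3 (q ^ 2 + 1) (q + 1) 1 blocks) {x y z : X}
    (hxy : x ≠ y) (hxz : x ≠ z) (hyz : y ≠ z) :
    (blocks.filter fun A => x ∈ A ∧ y ∉ A ∧ z ∉ A).card = q ^ 2 - q - 1 := by
  have h₁ := Finset.card_filter_add_card_filter_not (s := blocks.filter fun A => x ∈ A)
    (fun A => y ∈ A)
  have h₂ := Finset.card_filter_add_card_filter_not (s := blocks.filter fun A => x ∈ A ∧ y ∉ A)
    (fun A => z ∈ A)
  have h₃ := hD.card_inter_pair hxz hxy hyz.symm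
  simp only [Finset.filter_filter, and_assoc] at h₁ h₂
  rw [hD.card_through_pair hxy, hD.card_through_point] at h₁
  simp only [and_comm (a := _ ∉ _) (b := z ∈ _)] at h₂
  rw [h₃] at h₂
  rw [mul_add, ← pow_two] at h₁
  omega

/-- The number of blocks that meet three points in a prescribed proper nonempty subset. -/
theorem IsTDesign.card_pattern (hD : IsTDesign 3 (q ^ 2 + 1) (q + 1) 1 blocks) (u : Fin 3 ↪ X)
    (Y : Finset (Fin 3)) (hY : Y.Nonempty) (hY' : Y ≠ Finset.univ) :
    (blocks.filter fun A => ∀ j, u j ∈ A ↔ j ∈ Y).card =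
      if Y.card = 1 then q ^ 2 - q - 1 else q := by
  have h01 : u 0 ≠ u 1 := u.injective.ne (by decide)
  have h02 : u 0 ≠ u 2 := u.injective.ne (by decide)
  have h12 : u 1 ≠ u 2 := u.injective.ne (by decide)
  have hcases : Y = {0} ∨ Y = {1} ∨ Y = {2} ∨ Y = {0, 1} ∨ Y = {0, 2} ∨ Y = {1, 2} := by
    revert Y; decide
  simp only [Fin.forall_fin_succ, Fin.forall_fin_zero]
  rcases hcases with rfl | rfl | rfl | rfl | rfl | rfl
  · rw [if_pos (by decide), ← hD.card_inter_point h01 h02 h12]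
    congr 1; ext A; simp
  · rw [if_pos (by decide), ← hD.card_inter_point h01.symm h12 h02]
    congr 1; ext A; simp; tauto
  · rw [if_pos (by decide), ← hD.card_inter_point h02.symm h12.symm h01]
    congr 1; ext A; simp; tauto
  · rw [if_neg (by decide), ← hD.card_inter_pair h01 h02 h12]
    congr 1; ext A; simp
  · rw [if_neg (by decide), ← hD.card_inter_pair h02 h01 h12.symm]
    congr 1; ext A; simp; tauto
  · rw [if_neg (by decide), ← hD.card_inter_pair h12 h01.symm h02.symm]
    congr 1; ext A; simp; tauto

/-- Rows of the design whose stars in the columns `u` reproduce the delivery array. -/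
theorem IsTDesign.exists_row_embedding (hD : IsTDesign 3 (q ^ 2 + 1) (q + 1) 1 blocks)
    {a₁ a₂ : ℕ} (ha₁ : a₁ ≤ q ^ 2 - q - 1) (ha₂ : a₂ ≤ q) (u : Fin 3 ↪ X) :
    ∃ ψ : DesignRow 3 (fun s => if s = 1 then a₁ else a₂) ↪ {A // A ∈ blocks},
      ∀ f j, j ∈ f.1.1 ↔ u j ∈ (ψ f).1 := by
  have hemb : ∀ Y : {Y : Finset (Fin 3) // Y.Nonempty ∧ Y ≠ Finset.univ},
      Nonempty (Fin (if Y.1.card = 1 then a₁ else a₂) ↪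
        {A // A ∈ blocks.filter fun A => ∀ j, u j ∈ A ↔ j ∈ Y.1}) := by
    intro Y
    refine Function.Embedding.nonempty_of_card_le ?_
    rw [Fintype.card_fin, Fintype.card_coe, hD.card_pattern u Y.1 Y.2.1 Y.2.2]
    split_ifs <;> assumption
  let g := fun Y => (hemb Y).some
  have hg : ∀ Y i j, u j ∈ (g Y i).1 ↔ j ∈ Y.1 := fun Y i =>
    (Finset.mem_filter.1 (g Y i).2).2
  refine ⟨⟨fun f => ⟨(g f.1 f.2).1, (Finset.mem_filter.1 (g f.1 f.2).2).1⟩, ?_⟩,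
    fun f j => (hg f.1 f.2 j).symm⟩
  rintro ⟨Y, i⟩ ⟨Z, j⟩ h
  have h' : (g Y i).1 = (g Z j).1 := congrArg Subtype.val h
  -- A block determines its pattern on `u`, so the injections chosen for different patterns have
  -- disjoint images.
  have hYZ : Y = Z := by
    ext t
    rw [← hg Y i, ← hg Z j, h']
  subst hYZ
  have := (g Y).injective (Subtype.ext h')
  rw [this]

end DesignCounts

/-! ### MDS codes -/

namespace SubfileCode

variable {ρ φ : Type} {B : ℕ}

/-- Reed–Solomon codes over a large enough field of characteristic two. -/
theorem exists_code (ρ φ : Type) [Fintype ρ] [Finite φ] :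
    ∃ (B : ℕ) (C : SubfileCode ρ φ B), 0 < C.m ∧ B = Fintype.card ρ * C.m := by
  classical
  have := Fintype.ofFinite φ
  -- `2 ^ m` exceeds `|φ|`, so distinct evaluation points exist; the `+ 1` also keeps `m` positive
  -- when `φ` is empty.
  set m := Fintype.card φ + 1 with hm
  have hcard : Nat.card (GaloisField 2 m) = 2 ^ m := GaloisField.card 2 m (by omega)
  have := Fintype.ofFinite (GaloisField 2 m)
  rw [Nat.card_eq_fintype_card] at hcard
  obtain ⟨α⟩ : Nonempty (φ ↪ GaloisField 2 m) := by
    refine Function.Embedding.nonempty_of_card_le ?_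
    rw [hcard]
    have := Nat.lt_two_pow_self (n := m)
    omega
  let e := Fintype.equivFin ρ
  refine ⟨Fintype.card ρ * m,
    { m := m
      F := GaloisField 2 m
      split := Fintype.equivOfCardEq (by simp)
      symbol := Fintype.equivOfCardEq (by simp [hcard])
      G := fun f x => α x ^ (e f : ℕ)
      mds := fun g => ?_ }, by simp [hm], rfl⟩
  have hdet : ((Matrix.vandermonde fun i => α (g (e.symm i))).submatrix e e).det ≠ 0 := by
    rw [Matrix.det_submatrix_equiv_self, Matrix.det_vandermonde_ne_zero_iff]
    exact (α.injective.comp g.injective).comp e.symm.injective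
  have hrow : (fun i f : ρ => α (g i) ^ (e f : ℕ)) =
      ((Matrix.vandermonde fun i => α (g (e.symm i))).submatrix e e).row := by
    funext i f
    simp [Matrix.row, Matrix.vandermonde]
  rw [hrow]
  exact Matrix.linearIndependent_rows_of_det_ne_zero hdet

/-- A file is determined by any `|ρ|` of its coded subfiles. -/
theorem eq_of_coded_eq [Fintype ρ] (C : SubfileCode ρ φ B) {w w' : Fin B → Bool} (s : Finset φ)
    (hs : Fintype.card ρ ≤ s.card) (h : ∀ x ∈ s, C.coded w x = C.coded w' x) : w = w' := by
  classical
  obtain ⟨g⟩ : Nonempty (ρ ↪ s) := Function.Embedding.nonempty_of_card_le (by simpa using hs)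
  have hli := C.mds (g.trans (Function.Embedding.subtype _))
  let A : Matrix ρ ρ C.F := fun i f => C.G f (g i)
  have hA : IsUnit A := Matrix.linearIndependent_rows_iff_isUnit.1 hli
  have hsub : C.subfile w = C.subfile w' :=
    Matrix.mulVec_injective_iff_isUnit.2 hA (funext fun i => h (g i) (g i).2)
  funext b
  have := congrFun (C.symbol.injective (congrFun hsub (C.split b).1)) (C.split b).2
  simpa using this

end SubfileCode

/-! ### The delivery array and decoding -/

section Delivery

variable {a : ℕ → ℕ}

theorem designDelivery_eq_none {t : ℕ} {f : DesignRow t a} {j : Fin t} :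
    designDelivery t a f j = none ↔ j ∈ f.1.1 := by
  unfold designDelivery
  split_ifs with h <;> simp [h]

theorem designDelivery_eq_some {t : ℕ} {f : DesignRow t a} {j : Fin t} {s : Finset (Fin t) × ℕ} :
    designDelivery t a f j = some s ↔ j ∉ f.1.1 ∧ insert j f.1.1 = s.1 ∧ (f.2 : ℕ) = s.2 := by
  unfold designDelivery
  split_ifs with h <;> simp [h, Prod.ext_iff]

theorem card_designRow_three (a₁ a₂ : ℕ) :
    Fintype.card (DesignRow 3 fun s => if s = 1 then a₁ else a₂) = 3 * (a₁ + a₂) := by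
  rw [Fintype.card_sigma]
  simp only [Fintype.card_fin]
  have huniv : (Finset.univ : Finset {Y : Finset (Fin 3) // Y.Nonempty ∧ Y ≠ Finset.univ}) =
      {⟨{0}, by decide⟩, ⟨{1}, by decide⟩, ⟨{2}, by decide⟩, ⟨{0, 1}, by decide⟩,
        ⟨{0, 2}, by decide⟩, ⟨{1, 2}, by decide⟩} := by decide
  rw [huniv]
  repeat rw [Finset.sum_insert (by decide)]
  simp
  ring

variable {a₁ a₂ : ℕ}

theorem card_rows_coatom (a₁ a₂ : ℕ) (j : Fin 3) :
    (if ({j}ᶜ : Finset (Fin 3)).card = 1 then a₁ else a₂) = a₂ :=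
  if_neg (by rw [Finset.card_compl]; simp)

/-- The row `({j}ᶜ, i)` of the delivery array. -/
def coatomRow (a₁ : ℕ) {a₂ : ℕ} (j : Fin 3) (i : Fin a₂) :
    DesignRow 3 fun s => if s = 1 then a₁ else a₂ :=
  ⟨⟨{j}ᶜ, by revert j; decide⟩,
    i.castLE (card_rows_coatom a₁ a₂ j).ge⟩

theorem coatomRow_injective (j : Fin 3) : Function.Injective (coatomRow a₁ (a₂ := a₂) j) := by
  intro i i' h
  simpa [coatomRow] using h

/-- Adding one element `j` gives the whole set only from the complement of `j`; hence the integer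
occurs exactly once in each column when `i < a₂`. -/
theorem designDelivery_eq_some_univ {f : DesignRow 3 fun s => if s = 1 then a₁ else a₂}
    {j : Fin 3} {i : ℕ} :
    designDelivery 3 _ f j = some (Finset.univ, i) ↔
      ∃ h : i < a₂, f = coatomRow a₁ j ⟨i, h⟩ := by
  rw [designDelivery_eq_some]
  constructor
  · rintro ⟨hj, hins, hi⟩
    obtain ⟨⟨Y, hY⟩, i'⟩ := f
    simp only at hj hins hi
    have hYj : Y = {j}ᶜ := by
      rw [← Finset.erase_insert hj, hins]
      ext; simp
    subst hYj hi
    exact ⟨i'.2.trans_eq (card_rows_coatom a₁ a₂ j), rfl⟩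
  · rintro ⟨h, rfl⟩
    refine ⟨by simp [coatomRow], ?_, rfl⟩
    simp only [coatomRow]
    ext; simp

/-- The cached and the transmitted symbols determine the demanded file. -/
theorem eq_of_cache_eq_of_transmission_eq {X : Type} [Fintype X] [DecidableEq X] {q a B : ℕ}
    {blocks : Finset (Finset X)} (hD : IsTDesign 3 (q ^ 2 + 1) (q + 1) 1 blocks)
    (ha : a < a₂) (hsum : q * (q + 1) = a + 3 * a₁ + 2 * a₂)
    (C : SubfileCode (DesignRow 3 fun s => if s = 1 then a₁ else a₂) {A // A ∈ blocks} B)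
    (u : Fin 3 → X) (ψ : DesignRow 3 (fun s => if s = 1 then a₁ else a₂) ↪ {A // A ∈ blocks})
    (hψ : ∀ f j, j ∈ f.1.1 ↔ u j ∈ (ψ f).1) (w w' : Fin 3 → Fin B → Bool) (j : Fin 3)
    (hcache : ∀ j' x, u j ∈ x.1 → C.coded (w j') x = C.coded (w' j') x)
    (htrans : ∀ i, a ≤ i → i < a₂ →
      C.transmission (designDelivery 3 _) ψ w (Finset.univ, i) =
        C.transmission (designDelivery 3 _) ψ w' (Finset.univ, i)) :
    w j = w' j := by
  have hnew : ∀ i : Fin a₂, a ≤ i → C.coded (w j) (ψ (coatomRow a₁ j i)) =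
      C.coded (w' j) (ψ (coatomRow a₁ j i)) := by
    intro i hi
    have h := htrans i hi i.2
    have hrow : ∀ v : Fin 3 → Fin B → Bool,
        C.transmission (designDelivery 3 _) ψ v (Finset.univ, (i : ℕ)) =
          ∑ j' : Fin 3, C.coded (v j') (ψ (coatomRow a₁ j' i)) := by
      intro v
      unfold SubfileCode.transmission
      rw [Finset.sum_comm]
      refine Finset.sum_congr rfl fun j' _ => ?_
      simp [designDelivery_eq_some_univ]
    rw [hrow, hrow, ← Finset.add_sum_erase _ _ (Finset.mem_univ j),
      ← Finset.add_sum_erase _ (fun j' => C.coded (w' j') _) (Finset.mem_univ j)] at h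
    -- For `j' ≠ j` the pattern `{j'}ᶜ` contains `j`, so user `j` caches that term and can cancel
    -- it.
    rw [Finset.sum_congr rfl fun j' hj' => hcache j' (ψ (coatomRow a₁ j' i)) ((hψ _ _).1 (by
      simpa [coatomRow] using (Finset.ne_of_mem_erase hj').symm))] at h
    exact add_right_cancel h
  let s₁ : Finset {A // A ∈ blocks} := Finset.univ.filter fun x => u j ∈ x.1
  let s₂ : Finset {A // A ∈ blocks} := (Finset.univ.filter fun i : Fin a₂ => a ≤ i).map
    ⟨fun i => ψ (coatomRow a₁ j i), ψ.injective.comp (coatomRow_injective j)⟩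
  have hdisj : Disjoint s₁ s₂ := by
    rw [Finset.disjoint_left]
    intro x hx hx'
    obtain ⟨i, -, rfl⟩ := Finset.mem_map.1 hx'
    have := (hψ (coatomRow a₁ j i) j).2 (Finset.mem_filter.1 hx).2
    simp [coatomRow] at this
  have hs₁ : s₁.card = q * (q + 1) := hD.card_attach_through_point (u j)
  have hs₂ : s₂.card = a₂ - a := by
    rw [Finset.card_map, ← Finset.card_map Fin.valEmbedding, ← Nat.card_Ico]
    congr 1
    ext i
    simp only [Finset.mem_map, Finset.mem_filter, Finset.mem_univ, true_and, Fin.valEmbedding_apply,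
      Finset.mem_Ico]
    exact ⟨by rintro ⟨i, hi, rfl⟩; exact ⟨hi, i.2⟩, fun h => ⟨⟨i, h.2⟩, h.1, rfl⟩⟩
  -- The cached and the new symbols number `q(q+1) + (a₂ - a) = 3(a₁+a₂)`, the dimension of the
  -- code.
  refine C.eq_of_coded_eq (s₁ ∪ s₂) ?_ ?_
  · rw [card_designRow_three, Finset.card_union_of_disjoint hdisj, hs₁, hs₂]
    omega
  · intro x hx
    rcases Finset.mem_union.1 hx with hx | hx
    · exact hcache j x (Finset.mem_filter.1 hx).2
    · obtain ⟨i, hi, rfl⟩ := Finset.mem_map.1 hx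
      exact hnew i (Finset.mem_filter.1 hi).2

end Delivery

/-! ### Assembling the scheme -/

/-- A decoder exists as soon as the cache and the broadcast determine the demanded file. -/
theorem exists_hotplugScheme {K K' N B c r : ℕ}
    (place : (Fin N → Fin B → Bool) → Fin K → Fin c → Bool)
    (deliver : (I : Finset (Fin K)) → (I → Fin N) → (Fin N → Fin B → Bool) → Fin r → Bool)
    (h : ∀ I : Finset (Fin K), I.card = K' → ∀ (d : I → Fin N) (k : I) (W W' : Fin N → Fin B → Bool),
      place W k = place W' k → deliver I d W = deliver I d W' → W (d k) = W' (d k)) :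
    ∃ S : HotplugScheme K K' N B c r, S.place = place ∧ S.deliver = deliver := by
  classical
  -- Decode from any library consistent with the observations; the default is never reached on
  -- genuine ones.
  refine ⟨⟨place, deliver, fun I d k x y =>
    if hW : ∃ W, place W k = x ∧ deliver I d W = y then hW.choose (d k) else fun _ => false, ?_⟩,
    rfl, rfl⟩
  intro I hI d W k
  have hW : ∃ W', place W' k = place W k ∧ deliver I d W' = deliver I d W := ⟨W, rfl, rfl⟩
  rw [dif_pos hW]
  exact h I hI d k _ _ hW.choose_spec.1 hW.choose_spec.2

/-- The integers of the delivery array that are not transmitted. -/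
def redundantIntegers (a : ℕ) : Set (Finset (Fin 3) × ℕ) :=
  {s | s.1 ≠ Finset.univ ∨ s.2 < a}

theorem transmitted_iff {a₁ a₂ a : ℕ} (s : Finset (Fin 3) × ℕ) :
    (s ∉ redundantIntegers a ∧
      ∃ f j, designDelivery 3 (fun s => if s = 1 then a₁ else a₂) f j = some s) ↔
      s.1 = Finset.univ ∧ a ≤ s.2 ∧ s.2 < a₂ := by
  obtain ⟨Y, i⟩ := s
  simp only [redundantIntegers, Set.mem_ofPred_eq, not_or, not_not, not_lt]
  constructor
  · rintro ⟨⟨rfl, hi⟩, f, j, h⟩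
    obtain ⟨hi', -⟩ := designDelivery_eq_some_univ.1 h
    exact ⟨rfl, hi, hi'⟩
  · rintro ⟨rfl, hi, hi'⟩
    exact ⟨⟨rfl, hi⟩, coatomRow a₁ 0 ⟨i, hi'⟩, 0, designDelivery_eq_some_univ.2 ⟨hi', rfl⟩⟩

theorem nonempty_equiv_transmitted (a₁ a₂ a m : ℕ) :
    Nonempty (Fin ((a₂ - a) * m) ≃ {s : Finset (Fin 3) × ℕ // s ∉ redundantIntegers a ∧
      ∃ f j, designDelivery 3 (fun s => if s = 1 then a₁ else a₂) f j = some s} × Fin m) := by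
  let e : {s : Finset (Fin 3) × ℕ // s ∉ redundantIntegers a ∧
      ∃ f j, designDelivery 3 (fun s => if s = 1 then a₁ else a₂) f j = some s} ≃
      {i // i ∈ Finset.Ico a a₂} :=
    { toFun := fun s => ⟨s.1.2, Finset.mem_Ico.2 ((transmitted_iff s.1).1 s.2).2⟩
      invFun := fun i => ⟨(Finset.univ, i.1), (transmitted_iff _).2 ⟨rfl, Finset.mem_Ico.1 i.2⟩⟩
      left_inv := fun s => Subtype.ext (Prod.ext ((transmitted_iff s.1).1 s.2).1.symm rfl)
      right_inv := fun i => rfl }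
  exact ⟨finProdFinEquiv.symm.trans (Equiv.prodCongr
    ((Fintype.equivFinOfCardEq (by simp)).symm.trans e.symm) (Equiv.refl _))⟩

/-- The hotplug scheme of an inversive plane. -/
theorem IsTDesign.exists_arrayScheme {q a a₁ a₂ : ℕ} {blocks : Finset (Finset (Fin (q ^ 2 + 1)))}
    (hD : IsTDesign 3 (q ^ 2 + 1) (q + 1) 1 blocks) (N : ℕ) (ha₁ : a₁ ≤ q ^ 2 - q - 1)
    (ha₂ : a₂ ≤ q) (ha : a < a₂) (hsum : q * (q + 1) = a + 3 * a₁ + 2 * a₂) :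
    ∃ (m B : ℕ) (S : HotplugScheme (q ^ 2 + 1) 3 N B (N * (q * (q + 1) * m)) ((a₂ - a) * m)),
      0 < m ∧ B = 3 * (a₁ + a₂) * m ∧
      IsArrayScheme (designPlacement blocks)
        (designDelivery 3 (fun s => if s = 1 then a₁ else a₂)) (redundantIntegers a) S := by
  classical
  obtain ⟨B, C, hm, hB⟩ := SubfileCode.exists_code
    (DesignRow 3 fun s => if s = 1 then a₁ else a₂) {A // A ∈ blocks}
  rw [card_designRow_three] at hB
  have hcache : ∀ k : Fin (q ^ 2 + 1), Nonempty (Fin (N * (q * (q + 1) * C.m)) ≃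
      Fin N × {x : {A // A ∈ blocks} // designPlacement blocks x k} × Fin C.m) := by
    intro k
    refine ⟨(Finite.equivFinOfCardEq ?_).symm⟩
    have : Nat.card {x : {A // A ∈ blocks} // designPlacement blocks x k} = q * (q + 1) := by
      rw [Nat.card_eq_fintype_card, Fintype.card_subtype]
      rw [← hD.card_attach_through_point k]
      congr 1
      ext A
      rw [Finset.mem_filter, Finset.mem_filter]
      exact Iff.rfl
    rw [Nat.card_prod, Nat.card_prod, this, Nat.card_fin, Nat.card_fin]
  have ec := fun k => (hcache k).some
  obtain ⟨er⟩ := nonempty_equiv_transmitted a₁ a₂ a C.m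
  have hrows : ∀ (I : Finset (Fin (q ^ 2 + 1))) (hI : I.card = 3),
      ∃ ψ : DesignRow 3 (fun s => if s = 1 then a₁ else a₂) ↪ {A // A ∈ blocks},
        ∀ f j, j ∈ f.1.1 ↔ (I.orderIsoOfFin hI j : Fin (q ^ 2 + 1)) ∈ (ψ f).1 := fun I hI =>
    hD.exists_row_embedding ha₁ ha₂
      ((I.orderIsoOfFin hI).toEquiv.toEmbedding.trans (Function.Embedding.subtype _))
  choose ψ hψ using hrows
  obtain ⟨S, hplace, hdeliver⟩ := exists_hotplugScheme (K' := 3)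
    (fun (W : Fin N → Fin B → Bool) k b =>
      C.symbol.symm (C.coded (W (ec k b).1) (ec k b).2.1) (ec k b).2.2)
    -- Sets of other sizes are unconstrained, so the value there is arbitrary.
    (fun I d W b => if hI : I.card = 3 then
      C.symbol.symm (C.transmission (designDelivery 3 _) (ψ I hI)
        (fun j => W (d (I.orderIsoOfFin hI j))) (er b).1) (er b).2 else false) (by
    intro I hI d k W W' hc hr
    simp only [hI, dite_true] at hr
    have hc' : ∀ n x, (k : Fin (q ^ 2 + 1)) ∈ x.1 → C.coded (W n) x = C.coded (W' n) x := by
      intro n x hx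
      apply C.symbol.symm.injective
      funext i
      simpa using congrFun hc ((ec k).symm (n, ⟨x, hx⟩, i))
    obtain ⟨j, rfl⟩ := (I.orderIsoOfFin hI).surjective k
    refine eq_of_cache_eq_of_transmission_eq hD ha hsum C
      (fun j => (I.orderIsoOfFin hI j : Fin (q ^ 2 + 1))) (ψ I hI) (hψ I hI)
      (fun j => W (d (I.orderIsoOfFin hI j))) (fun j => W' (d (I.orderIsoOfFin hI j))) j
      (fun j' x hx => hc' _ x hx) fun i hi hi' => ?_
    apply C.symbol.symm.injective
    funext b
    simpa using congrFun hr
      (er.symm (⟨(Finset.univ, i), (transmitted_iff _).2 ⟨rfl, hi, hi'⟩⟩, b)))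
  refine ⟨C.m, B, S, hm, hB, C, fun k => ⟨ec k, fun W b => by rw [hplace]⟩, fun I hI =>
    ⟨ψ I hI, fun f j => designDelivery_eq_none.trans (hψ I hI f j), fun d => ⟨er, fun W b => ?_⟩⟩⟩
  rw [hdeliver]
  simp only [hI, dite_true]

/-! ### The converse and the cut-set bound -/

/-- The cut-set bound for one user and `N` demands. -/
theorem HotplugScheme.mul_le_add_mul {K K' N B c r : ℕ} (S : HotplugScheme K K' N B c r)
    (hK' : 0 < K') (hK : K' ≤ K) : N * B ≤ c + N * r := by
  obtain ⟨I, -, hI⟩ := Finset.exists_subset_card_eq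
    (show K' ≤ (Finset.univ : Finset (Fin K)).card by simpa using hK)
  obtain ⟨k, hk⟩ := Finset.card_pos.1 (hI ▸ hK')
  -- In the `n`-th broadcast every active user demands file `n`, so user `k` recovers all files in
  -- turn.
  let F : (Fin N → Fin B → Bool) → (Fin c → Bool) × (Fin N → Fin r → Bool) := fun W =>
    (S.place W k, fun n => S.deliver I (fun _ => n) W)
  have hF : Function.Injective F := by
    intro W W' h
    funext n
    rw [← S.correct I hI (fun _ => n) W ⟨k, hk⟩, ← S.correct I hI (fun _ => n) W' ⟨k, hk⟩,
      show S.place W k = S.place W' k from congrArg Prod.fst h,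
      show S.deliver I (fun _ => n) W = S.deliver I (fun _ => n) W' from
        congrFun (congrArg Prod.snd h) n]
  have h := Fintype.card_le_of_injective F hF
  simp only [Fintype.card_pi, Fintype.card_bool, Fintype.card_prod, Finset.prod_const,
    Finset.card_univ, Fintype.card_fin, ← pow_mul, ← pow_add] at h
  rw [mul_comm N B, mul_comm N r]
  exact (Nat.pow_le_pow_iff_right (by norm_num)).1 h

theorem IsAchievable.one_sub_div_le {K K' N : ℕ} {M R : ℝ} (h : IsAchievable K K' N M R)
    (hN : 0 < N) (hK' : 0 < K') (hK : K' ≤ K) : 1 - M / N ≤ R := by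
  obtain ⟨B, c, r, hB, hc, hr, ⟨S⟩⟩ := h
  have h : (N : ℝ) * B ≤ c + N * r := by exact_mod_cast S.mul_le_add_mul hK' hK
  have hN' : (0 : ℝ) < N := by exact_mod_cast hN
  have hB' : (0 : ℝ) < B := by exact_mod_cast hB
  have h₁ : (N : ℝ) * B ≤ M * B + N * (R * B) := h.trans (by gcongr)
  have h₂ : (N : ℝ) ≤ M + N * R := le_of_mul_le_mul_right (by linarith) hB'
  rw [sub_le_iff_le_add, ← sub_le_iff_le_add', le_div_iff₀ hN']
  linarith

/-- For `M ≥ N / 2`, one user gives the strongest of the cut-set bounds. -/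
theorem meetsCutSetBound_one_sub_div {N K' : ℕ} {M : ℝ} (hN : 0 < N) (hK' : 0 < K')
    (hM : 1 / 2 ≤ M / N) : MeetsCutSetBound N K' M (1 - M / N) := by
  have hN' : (0 : ℝ) < N := by exact_mod_cast hN
  refine ⟨⟨1, ⟨le_rfl, by simp; omega⟩, by simp; ring⟩, ?_⟩
  rintro _ ⟨s, ⟨hs, hs'⟩, rfl⟩
  have hsN : s ≤ N := hs'.trans (min_le_left _ _)
  have hs0 : (0 : ℝ) < s := by exact_mod_cast hs
  have hs1 : (1 : ℝ) ≤ s := by exact_mod_cast hs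
  have hdiv : (0 : ℝ) < (N / s : ℕ) := by exact_mod_cast Nat.div_pos hsN hs
  have hle : ((N / s : ℕ) : ℝ) ≤ N / s := Nat.cast_div_le
  have hM0 : 0 ≤ M := by
    have : M = M / N * N := by field_simp
    rw [this]; positivity
  have h₁ : (s : ℝ) ^ 2 * (M / N) ≤ s / ((N / s : ℕ) : ℝ) * M := by
    have : (s : ℝ) ^ 2 * (M / N) = s / (N / s) * M := by field_simp
    rw [this]
    gcongr
  have h₂ : 1 ≤ (s + 1) * (M / N) := by nlinarith
  simp only
  -- With `x = M/N`, `(1 - x) - (s - s^2 x) = (s - 1)((s + 1)x - 1) ≥ 0`.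
  nlinarith [mul_nonneg (sub_nonneg.2 hs1) (sub_nonneg.2 h₂)]

/-! ### The main theorem -/

theorem mainTheorem4 (q : ℕ) (hq : IsPrimePow q) (hq3 : 3 ≤ q) (N : ℕ) (hN : 0 < N)
    (a₁ a₂ a : ℕ) (ha₁ : a₁ ≤ q ^ 2 - q - 1) (ha₂ : a₂ ≤ q) (ha : a < a₂)
    (hsum : q * (q + 1) = a + 3 * a₁ + 2 * a₂)
    (M R : ℝ) (hM : M / N = (q * (q + 1) : ℝ) / (3 * (a₁ + a₂)))
    (hR : R = (3 * (a₁ + a₂) - q * (q + 1) : ℝ) / (3 * (a₁ + a₂))) :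
    (∃ blocks : Finset (Finset (Fin (q ^ 2 + 1))),
      IsTDesign 3 (q ^ 2 + 1) (q + 1) 1 blocks ∧
      ∃ (T : Set (Finset (Fin 3) × ℕ)) (B c r : ℕ) (S : HotplugScheme (q ^ 2 + 1) 3 N B c r),
        0 < B ∧ (c : ℝ) = M * B ∧ (r : ℝ) = R * B ∧
        IsArrayScheme (designPlacement blocks)
          (designDelivery 3 (fun s => if s = 1 then a₁ else a₂)) T S) ∧
    R = 1 - M / N ∧
    MeetsCutSetBound N 3 M R ∧
    IsOptimalRate (q ^ 2 + 1) 3 N M R := by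
  have hN' : (0 : ℝ) < N := by exact_mod_cast hN
  have hden : (0 : ℝ) < 3 * (a₁ + a₂) := by
    have : 0 < 3 * (a₁ + a₂) := by omega
    exact_mod_cast this
  have hden' : (a₁ + a₂ : ℝ) ≠ 0 := (pos_of_mul_pos_right hden (by norm_num)).ne'
  have hsumR : (q * (q + 1) : ℝ) = a + 3 * a₁ + 2 * a₂ := by exact_mod_cast hsum
  have hRM : R = 1 - M / N := by rw [hR, hM, sub_div, div_self hden.ne']
  obtain ⟨blocks, hD⟩ := exists_isTDesign_inversive hq
  obtain ⟨m, B, S, hm, hB, hS⟩ := hD.exists_arrayScheme N ha₁ ha₂ ha hsum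
  have hB0 : 0 < B := by rw [hB]; exact Nat.mul_pos (by omega) hm
  have hBR : (B : ℝ) = 3 * (a₁ + a₂) * m := by rw [hB]; push_cast; ring
  have hc : ((N * (q * (q + 1) * m) : ℕ) : ℝ) = M * B := by
    rw [(div_eq_iff hN'.ne').1 hM, hBR]
    push_cast
    field_simp
  have hr : (((a₂ - a) * m : ℕ) : ℝ) = R * B := by
    rw [hR, hBR, hsumR]
    push_cast [ha.le]
    field_simp
    ring
  refine ⟨⟨blocks, hD, redundantIntegers a, B, _, _, S, hB0, hc, hr, hS⟩, hRM, ?_, ?_⟩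
  · rw [hRM]
    refine meetsCutSetBound_one_sub_div hN (by norm_num) ?_
    -- `M/N ≥ 1/2` because `2(a + 3a₁ + 2a₂) ≥ 3(a₁ + a₂)`.
    rw [hM, hsumR, le_div_iff₀ hden]
    have h₁ : (0 : ℝ) ≤ a₁ := Nat.cast_nonneg _
    have h₂ : (0 : ℝ) ≤ a₂ := Nat.cast_nonneg _
    have h₃ : (0 : ℝ) ≤ a := Nat.cast_nonneg _
    linarith
  · refine ⟨⟨B, _, _, hB0, hc.le, hr.le, ⟨S⟩⟩, fun R' h => ?_⟩
    rw [hRM]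
    exact IsAchievable.one_sub_div_le h hN (by norm_num) (by nlinarith)
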